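/- Consider formal short normal-play games $G=\{G^L\mid G^R\}$, i.e. finite game trees in which each position has finitely many Left options $G^L$ and finitely many Right options $G^R$. Let $G\le H$ be the usual order (no $G^L\ge H$ and no $H^R\le G$), say that $G$ is *equal* to $H$ if $G\le H$ and $H\le G$, and let $G+H=\{G^L+H,\,G+H^L\mid G^R+H,\,G+H^R\}$ be the disjunctive sum. The integers are identified with the games $0=\{\,\mid\,\}$, $n+1=\{n\mid\,\}$ and $-(n+1)=\{\,\mid -n\}$ for $n\ge 0$. For each game $G$ define functions $t\mapsto\lambda_t(G)$ and $t\mapsto\rho_t(G)$ from $\mathbb{Z}[\tfrac12]$ to $\mathbb{Z}[\tfrac12]$, and the temperature $t(G)\in\mathbb{Z}[\tfrac12]\cup\{-\infty\}$, by recursion as follows. 1. If $G$ is equal to an integer $n$, then $\lambda_t(G)=\rho_t(G)=n$ for all $t$, and $t(G)=-\infty$. 2. Otherwise let $\widetilde\lambda_t(G)=\max_{G^L}\{\rho_t(G^L)-t\}$ and $\widetilde\rho_t(G)=\min_{G^R}\{\lambda_t(G^R)+t\}$, and $$t(G)=\min\{t\in\mathbb{Z}[\tfrac12] : \widetilde\lambda_t(G)=\widetilde\rho_t(G)\}.$$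 For $t\le t(G)$ put $\lambda_t(G)=\widetilde\lambda_t(G)$ and $\rho_t(G)=\widetilde\rho_t(G)$; for $t>t(G)$ put $\lambda_t(G)=\rho_t(G)=x$, where $x=\widetilde\lambda_{t(G)}(G)=\widetilde\rho_{t(G)}(G)$. Then the temperature is well defined for every game (in case 2 there are Left options and Right options, and the minimum defining $t(G)$ exists), and for all games $G$ and $H$, $$t(G+H)\le\max\{t(G),t(H)\}.$$ -/

import Mathlib

/-- Formal short (finite, loop-free) normal-play games `{G^L | G^R}`: finitely many left options and
finitely many right options, each given by a finite family. -/
inductive ShortGame : Type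
  | mk (m n : ℕ) (L : Fin m → ShortGame) (R : Fin n → ShortGame) : ShortGame

namespace ShortGame

/-- The number of left options (counted with repetition in the family). -/
def numLeft : ShortGame → ℕ
  | mk m _ _ _ => m

/-- The number of right options (counted with repetition in the family). -/
def numRight : ShortGame → ℕ
  | mk _ n _ _ => n

/-- The left options. -/
def left : (G : ShortGame) → Fin G.numLeft → ShortGame
  | mk _ _ L _ => L

/-- The right options. -/
def right : (G : ShortGame) → Fin G.numRight → ShortGame
  | mk _ _ _ R => R

/-- The formal birthday: the height of the game tree. -/
def birthday : ShortGame → ℕ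
  | mk _ _ L R =>
    max (Finset.univ.sup fun i => birthday (L i) + 1) (Finset.univ.sup fun j => birthday (R j) + 1)

theorem birthday_left_lt (G : ShortGame) (i : Fin G.numLeft) :
    (G.left i).birthday < G.birthday := by
  cases G with
  | mk m n L R =>
    have h := Finset.le_sup (f := fun i => birthday (L i) + 1) (Finset.mem_univ i)
    simp only [birthday, left]
    exact lt_of_lt_of_le (Nat.lt_of_succ_le h) (le_max_left _ _)

theorem birthday_right_lt (G : ShortGame) (j : Fin G.numRight) :
    (G.right j).birthday < G.birthday := by
  cases G with
  | mk m n L R =>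
    have h := Finset.le_sup (f := fun j => birthday (R j) + 1) (Finset.mem_univ j)
    simp only [birthday, right]
    exact lt_of_lt_of_le (Nat.lt_of_succ_le h) (le_max_right _ _)

/-- Conway's order: `G ≤ H` iff no left option of `G` is `≥ H` and no right option of `H`
is `≤ G`. -/
def Le (G H : ShortGame) : Prop :=
  (∀ i : Fin G.numLeft, ¬ Le H (G.left i)) ∧ ∀ j : Fin H.numRight, ¬ Le (H.right j) G
termination_by G.birthday + H.birthday
decreasing_by
  · have := birthday_left_lt G i
    omega
  · have := birthday_right_lt H j
    omega

instance : LE ShortGame := ⟨Le⟩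

theorem le_iff (G H : ShortGame) :
    G ≤ H ↔ (∀ i : Fin G.numLeft, ¬ H ≤ G.left i) ∧ ∀ j : Fin H.numRight, ¬ H.right j ≤ G := by
  change Le G H ↔ _
  rw [Le]
  rfl

/-- Equality of game values. -/
def Equiv (G H : ShortGame) : Prop := G ≤ H ∧ H ≤ G

/-- The disjunctive sum
`G + H = {G^L + H, G + H^L | G^R + H, G + H^R}`. -/
def add (G H : ShortGame) : ShortGame :=
  mk (G.numLeft + H.numLeft) (G.numRight + H.numRight)
    (Fin.addCases (fun i => add (G.left i) H) (fun i => add G (H.left i)))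
    (Fin.addCases (fun j => add (G.right j) H) (fun j => add G (H.right j)))
termination_by G.birthday + H.birthday
decreasing_by
  · have := birthday_left_lt G i
    omega
  · have := birthday_left_lt H i
    omega
  · have := birthday_right_lt G j
    omega
  · have := birthday_right_lt H j
    omega

instance : Add ShortGame := ⟨add⟩

theorem add_def (G H : ShortGame) :
    G + H = mk (G.numLeft + H.numLeft) (G.numRight + H.numRight)
      (Fin.addCases (fun i => G.left i + H) (fun i => G + H.left i))
      (Fin.addCases (fun j => G.right j + H) (fun j => G + H.right j)) := by
  change add G H = _
  rw [add]
  rfl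

/-- The canonical form of a natural number: `0 = { | }` and `n + 1 = {n | }`. -/
def ofNat : ℕ → ShortGame
  | 0 => mk 0 0 Fin.elim0 Fin.elim0
  | n + 1 => mk 1 0 (fun _ => ofNat n) Fin.elim0

/-- The canonical form of minus a natural number: `0 = { | }` and `-(n + 1) = { | -n}`. -/
def ofNegNat : ℕ → ShortGame
  | 0 => mk 0 0 Fin.elim0 Fin.elim0
  | n + 1 => mk 0 1 Fin.elim0 (fun _ => ofNegNat n)

/-- The canonical form of an integer. -/
def ofInt : ℤ → ShortGame
  | Int.ofNat n => ofNat n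
  | Int.negSucc n => ofNegNat (n + 1)

/-- `G` is equal (in value) to an integer. -/
def IsInteger (G : ShortGame) : Prop := ∃ k : ℤ, Equiv G (ofInt k)

open Classical in
/-- The integer to which `G` is equal (with value `0` if there is none). -/
noncomputable def intValue (G : ShortGame) : ℤ :=
  if h : ∃ k : ℤ, Equiv G (ofInt k) then Classical.choose h else 0

end ShortGame

/-- The ordered ring `ℤ[1/2]` of dyadic rationals, as a subring of `ℚ`. -/
abbrev DyadicRat : Type := Subring.closure ({1 / 2} : Set ℚ)

/-- The maximum of a nonempty finite family (with value `0` for the empty family). -/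
def finMax {m : ℕ} (f : Fin m → DyadicRat) : DyadicRat :=
  if h : (Finset.univ : Finset (Fin m)).Nonempty then Finset.univ.sup' h f else 0

/-- The minimum of a nonempty finite family (with value `0` for the empty family). -/
def finMin {m : ℕ} (f : Fin m → DyadicRat) : DyadicRat :=
  if h : (Finset.univ : Finset (Fin m)).Nonempty then Finset.univ.inf' h f else 0

/-- The two walls `λ_t(G)`, `ρ_t(G)`, as functions of `t`, together with the temperature `t(G)`. -/
structure ThermographData where
  leftWall : DyadicRat → DyadicRat
  rightWall : DyadicRat → DyadicRat
  temp : WithBot DyadicRat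

open Classical in
/-- The least `t` with `l t = r t` (with value `0` if there is none). -/
noncomputable def meetTime (l r : DyadicRat → DyadicRat) : DyadicRat :=
  if h : ∃ t, IsLeast {t | l t = r t} t then Classical.choose h else 0

/-- Cut two scaffolds `l`, `r` at the least `τ` where they meet: the walls are `l`, `r` up to `τ`,
and constantly equal to the common value at `τ` from there on. -/
noncomputable def freeze (l r : DyadicRat → DyadicRat) : ThermographData where
  leftWall t := if t ≤ meetTime l r then l t else l (meetTime l r)
  rightWall t := if t ≤ meetTime l r then r t else r (meetTime l r)
  temp := (meetTime l r : DyadicRat)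

namespace ShortGame

open Classical in
/-- The walls and the temperature of `G`, by recursion on `G`. If `G` is equal to an integer `k`,
both walls are constantly `k` and the temperature is `-∞`. Otherwise the scaffolds
`max (ρ_t(G^L) - t)` and `min (λ_t(G^R) + t)` are cut where they first meet. -/
noncomputable def thermograph : ShortGame → ThermographData
  | mk m n L R =>
    if IsInteger (mk m n L R) then
      { leftWall := fun _ => (intValue (mk m n L R) : DyadicRat)
        rightWall := fun _ => (intValue (mk m n L R) : DyadicRat)
        temp := ⊥ }
    else
      freeze (fun t => finMax fun i => (thermograph (L i)).rightWall t - t)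
        (fun t => finMin fun j => (thermograph (R j)).leftWall t + t)

/-- The left scaffold, the maximum of `ρ_t(G^L) - t` over the left options. -/
noncomputable def leftScaffold (G : ShortGame) (t : DyadicRat) : DyadicRat :=
  finMax fun i => (G.left i).thermograph.rightWall t - t

/-- The right scaffold, the minimum of `λ_t(G^R) + t` over the right options. -/
noncomputable def rightScaffold (G : ShortGame) (t : DyadicRat) : DyadicRat :=
  finMin fun j => (G.right j).thermograph.leftWall t + t

/-- The temperature `t(G)`. -/
noncomputable def temp (G : ShortGame) : WithBot DyadicRat := G.thermograph.temp

/-- No default value is used in the step of the definition of the temperature at `G`: if `G` is not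
equal to an integer, the maximum and the minimum range over nonempty sets, and there is a least
time where the scaffolds meet, which is the temperature. -/
def TempWellDefined (G : ShortGame) : Prop :=
  ¬ G.IsInteger → 0 < G.numLeft ∧ 0 < G.numRight ∧
    ∃ τ : DyadicRat, IsLeast {t | G.leftScaffold t = G.rightScaffold t} τ ∧ G.temp = τ

end ShortGame

/-! Well-definedness is an induction on the game tree. Left walls are piecewise affine with slopes
`0` and `-1`, right walls with slopes `0` and `1`, on a dyadic grid, so the left scaffold descends
and the right one ascends, again on a grid. Every wall of an option is bounded on the side that
matters, so the scaffolds eventually meet or cross. They are strictly apart, with the left one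
above, at `t = -1`: otherwise an integer fits between the Left and Right options, and by the
simplicity rule (`isInteger_of_fits`) the game is an integer. A first meeting point then exists, and
halving the grid once makes it a grid point (`exists_isLeast_meet`). The link between order and
walls is `Bounded`: comparisons of a game with integers bound its walls at all times `s ≥ -1`.

For sums, at every `s ≥ -1` the walls satisfy `ρ(G) + ρ(H) ≤ ρ(G + H)` and `λ(G + H) ≤ λ(G) + λ(H)`,
each proved jointly with two mixed inequalities (`walls_add_ge`, `walls_add_le`). The walls of a
game agree at `s` exactly when its temperature is at most `s` (`walls_eq_iff_temp_le`). At the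
larger of the two temperatures the walls of `G` agree and so do those of `H`, so the walls of `G +
H` are squeezed together there. If both temperatures are `-∞`, the sum is an integer. -/

namespace ShortGame

/-! ### Order and disjunctive sum. -/

/-- Statements about options of a sum are transported through this equivalence, with an explicit
predicate, so that the indices of the combined family never have to be handled again. -/
theorem forall_left_add {P : ShortGame → Prop} (G H : ShortGame) :
    (∀ i, P ((G + H).left i)) ↔ (∀ i, P (G.left i + H)) ∧ ∀ i, P (G + H.left i) := by
  rw [add_def]
  refine ⟨fun h => ⟨fun i => ?_, fun i => ?_⟩, fun h i => ?_⟩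
  · simpa [left] using h (Fin.castAdd _ i)
  · simpa [left] using h (Fin.natAdd _ i)
  · refine Fin.addCases (fun i => ?_) (fun i => ?_) i
    · simpa [left] using h.1 i
    · simpa [left] using h.2 i

theorem forall_right_add {P : ShortGame → Prop} (G H : ShortGame) :
    (∀ i, P ((G + H).right i)) ↔ (∀ i, P (G.right i + H)) ∧ ∀ i, P (G + H.right i) := by
  rw [add_def]
  refine ⟨fun h => ⟨fun i => ?_, fun i => ?_⟩, fun h i => ?_⟩
  · simpa [right] using h (Fin.castAdd _ i)
  · simpa [right] using h (Fin.natAdd _ i)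
  · refine Fin.addCases (fun i => ?_) (fun i => ?_) i
    · simpa [right] using h.1 i
    · simpa [right] using h.2 i

theorem not_le_left {G H : ShortGame} (h : G ≤ H) (i) : ¬ H ≤ G.left i :=
  ((le_iff G H).1 h).1 i

theorem not_right_le {G H : ShortGame} (h : G ≤ H) (j) : ¬ H.right j ≤ G :=
  ((le_iff G H).1 h).2 j

theorem exists_of_not_le {G H : ShortGame} (h : ¬ G ≤ H) :
    (∃ i, H ≤ G.left i) ∨ ∃ j, H.right j ≤ G := by
  rw [le_iff] at h
  by_contra! hc
  exact h hc

protected theorem le_refl (G : ShortGame) : G ≤ G := by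
  rw [le_iff]
  refine ⟨fun i h => ?_, fun j h => ?_⟩
  · exact not_le_left h i (ShortGame.le_refl (G.left i))
  · exact not_right_le h j (ShortGame.le_refl (G.right j))
termination_by G.birthday
decreasing_by
  · exact birthday_left_lt G i
  · exact birthday_right_lt G j

protected theorem le_trans {G H K : ShortGame} (h₁ : G ≤ H) (h₂ : H ≤ K) : G ≤ K := by
  rw [le_iff]
  refine ⟨fun i h => ?_, fun j h => ?_⟩
  · exact not_le_left h₁ i (ShortGame.le_trans h₂ h)
  · exact not_right_le h₂ j (ShortGame.le_trans h h₁)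
termination_by G.birthday + H.birthday + K.birthday
decreasing_by
  · have := birthday_left_lt G i
    omega
  · have := birthday_right_lt K j
    omega

protected theorem add_le_add {G G' H H' : ShortGame} (h₁ : G ≤ G') (h₂ : H ≤ H') :
    G + H ≤ G' + H' := by
  rw [le_iff, forall_left_add (P := fun X => ¬ G' + H' ≤ X),
    forall_right_add (P := fun X => ¬ X ≤ G + H)]
  refine ⟨⟨fun i h => ?_, fun i h => ?_⟩, fun j h => ?_, fun j h => ?_⟩
  · rcases exists_of_not_le (not_le_left h₁ i) with ⟨k, hk⟩ | ⟨k, hk⟩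
    · rw [le_iff, forall_left_add (P := fun X => ¬ G.left i + H ≤ X)] at h
      exact h.1.1 k (ShortGame.add_le_add hk h₂)
    · rw [le_iff, forall_right_add (P := fun X => ¬ X ≤ G' + H')] at h
      exact h.2.1 k (ShortGame.add_le_add hk h₂)
  · rcases exists_of_not_le (not_le_left h₂ i) with ⟨k, hk⟩ | ⟨k, hk⟩
    · rw [le_iff, forall_left_add (P := fun X => ¬ G + H.left i ≤ X)] at h
      exact h.1.2 k (ShortGame.add_le_add h₁ hk)
    · rw [le_iff, forall_right_add (P := fun X => ¬ X ≤ G' + H')] at h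
      exact h.2.2 k (ShortGame.add_le_add h₁ hk)
  · rcases exists_of_not_le (not_right_le h₁ j) with ⟨k, hk⟩ | ⟨k, hk⟩
    · rw [le_iff, forall_left_add (P := fun X => ¬ G + H ≤ X)] at h
      exact h.1.1 k (ShortGame.add_le_add hk h₂)
    · rw [le_iff, forall_right_add (P := fun X => ¬ X ≤ G'.right j + H')] at h
      exact h.2.1 k (ShortGame.add_le_add hk h₂)
  · rcases exists_of_not_le (not_right_le h₂ j) with ⟨k, hk⟩ | ⟨k, hk⟩
    · rw [le_iff, forall_left_add (P := fun X => ¬ G + H ≤ X)] at h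
      exact h.1.2 k (ShortGame.add_le_add h₁ hk)
    · rw [le_iff, forall_right_add (P := fun X => ¬ X ≤ G' + H'.right j)] at h
      exact h.2.2 k (ShortGame.add_le_add h₁ hk)
termination_by G.birthday + G'.birthday + H.birthday + H'.birthday
decreasing_by
  · have := birthday_left_lt G i
    have := birthday_left_lt G' k
    omega
  · have := birthday_left_lt G i
    have := birthday_right_lt (G.left i) k
    omega
  · have := birthday_left_lt H i
    have := birthday_left_lt H' k
    omega
  · have := birthday_left_lt H i
    have := birthday_right_lt (H.left i) k
    omega
  · have := birthday_right_lt G' j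
    have := birthday_left_lt (G'.right j) k
    omega
  · have := birthday_right_lt G' j
    have := birthday_right_lt G k
    omega
  · have := birthday_right_lt H' j
    have := birthday_left_lt (H'.right j) k
    omega
  · have := birthday_right_lt H' j
    have := birthday_right_lt H k
    omega

/-! ### Integers as games. -/

theorem forall_left_ofInt {P : ShortGame → Prop} (n : ℤ) :
    (∀ i, P ((ofInt n).left i)) ↔ (0 < n → P (ofInt (n - 1))) := by
  rcases n with (_ | n) | n
  · exact ⟨fun _ h => absurd h (by simp), fun _ i => i.elim0⟩
  · have h : ofInt (Int.ofNat (n + 1) - 1) = ofNat n := by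
      rw [show Int.ofNat (n + 1) - 1 = Int.ofNat n by simp]
      rfl
    rw [h]
    exact ⟨fun h _ => h ⟨0, Nat.one_pos⟩, fun h _ => h (by simp)⟩
  · exact ⟨fun _ h => absurd h (by omega), fun _ i => i.elim0⟩

theorem forall_right_ofInt {P : ShortGame → Prop} (n : ℤ) :
    (∀ i, P ((ofInt n).right i)) ↔ (n < 0 → P (ofInt (n + 1))) := by
  rcases n with (_ | n) | n
  · exact ⟨fun _ h => absurd h (by simp), fun _ i => i.elim0⟩
  · exact ⟨fun _ h => absurd h (by simp; omega), fun _ i => i.elim0⟩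
  · have h : ofInt (Int.negSucc n + 1) = ofNegNat n := by cases n <;> rfl
    rw [h]
    exact ⟨fun h _ => h ⟨0, Nat.one_pos⟩, fun h _ => h (by omega)⟩

theorem le_ofInt_iff (G : ShortGame) (n : ℤ) :
    G ≤ ofInt n ↔ (∀ i, ¬ ofInt n ≤ G.left i) ∧ (n < 0 → ¬ ofInt (n + 1) ≤ G) := by
  rw [le_iff, forall_right_ofInt (P := fun X => ¬ X ≤ G)]

theorem ofInt_le_iff (G : ShortGame) (n : ℤ) :
    ofInt n ≤ G ↔ (0 < n → ¬ G ≤ ofInt (n - 1)) ∧ ∀ j, ¬ G.right j ≤ ofInt n := by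
  rw [le_iff, forall_left_ofInt (P := fun X => ¬ G ≤ X)]

theorem ofInt_le_succ (n : ℤ) : ofInt n ≤ ofInt (n + 1) ∧ ¬ ofInt (n + 1) ≤ ofInt n := by
  rcases le_or_gt 0 n with hn | hn
  · have h : ¬ ofInt (n + 1) ≤ ofInt n := by
      rw [ofInt_le_iff]
      intro h
      have := h.1 (by omega)
      rw [add_sub_cancel_right] at this
      exact this (ShortGame.le_refl _)
    refine ⟨?_, h⟩
    rw [ofInt_le_iff]
    refine ⟨fun h0 => ?_, ?_⟩
    · have ih := ofInt_le_succ (n - 1)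
      rw [sub_add_cancel] at ih
      exact fun h' => h (ShortGame.le_trans h' ih.1)
    · rw [forall_right_ofInt (P := fun X => ¬ X ≤ ofInt n)]
      omega
  · have h : ¬ ofInt (n + 1) ≤ ofInt n := by
      rw [le_ofInt_iff]
      exact fun h => h.2 hn (ShortGame.le_refl _)
    refine ⟨?_, h⟩
    rw [le_ofInt_iff]
    refine ⟨?_, fun h0 => ?_⟩
    · rw [forall_left_ofInt (P := fun X => ¬ ofInt (n + 1) ≤ X)]
      omega
    · have ih := ofInt_le_succ (n + 1)
      exact fun h' => h (ShortGame.le_trans ih.1 h')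
termination_by n.natAbs

theorem ofInt_le_ofInt {m n : ℤ} : ofInt m ≤ ofInt n ↔ m ≤ n := by
  have key : ∀ (m : ℤ) (k : ℕ), ofInt m ≤ ofInt (m + k) := by
    intro m k
    induction k with
    | zero => simpa using ShortGame.le_refl (ofInt m)
    | succ k ih =>
      push_cast
      rw [← add_assoc]
      exact ShortGame.le_trans ih (ofInt_le_succ _).1
  have key' : ∀ {m n : ℤ}, m ≤ n → ofInt m ≤ ofInt n := by
    intro m n h
    have := key m (n - m).toNat
    rwa [Int.toNat_of_nonneg (by omega), add_sub_cancel] at this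
  refine ⟨fun h => ?_, key'⟩
  by_contra! hc
  exact (ofInt_le_succ n).2 (ShortGame.le_trans (key' hc) h)

theorem ofInt_add_ofInt (m n : ℤ) : Equiv (ofInt m + ofInt n) (ofInt (m + n)) := by
  have hl : ∀ i, ¬ ofInt (m + n) ≤ (ofInt m + ofInt n).left i := by
    rw [forall_left_add (P := fun X => ¬ ofInt (m + n) ≤ X),
      forall_left_ofInt (P := fun X => ¬ ofInt (m + n) ≤ X + ofInt n),
      forall_left_ofInt (P := fun X => ¬ ofInt (m + n) ≤ ofInt m + X)]
    refine ⟨fun h0 h => ?_, fun h0 h => ?_⟩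
    · have := ofInt_le_ofInt.1 (ShortGame.le_trans h (ofInt_add_ofInt (m - 1) n).1)
      omega
    · have := ofInt_le_ofInt.1 (ShortGame.le_trans h (ofInt_add_ofInt m (n - 1)).1)
      omega
  have hr : ∀ i, ¬ (ofInt m + ofInt n).right i ≤ ofInt (m + n) := by
    rw [forall_right_add (P := fun X => ¬ X ≤ ofInt (m + n)),
      forall_right_ofInt (P := fun X => ¬ X + ofInt n ≤ ofInt (m + n)),
      forall_right_ofInt (P := fun X => ¬ ofInt m + X ≤ ofInt (m + n))]
    refine ⟨fun h0 h => ?_, fun h0 h => ?_⟩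
    · have := ofInt_le_ofInt.1 (ShortGame.le_trans (ofInt_add_ofInt (m + 1) n).2 h)
      omega
    · have := ofInt_le_ofInt.1 (ShortGame.le_trans (ofInt_add_ofInt m (n + 1)).2 h)
      omega
  refine ⟨(le_ofInt_iff _ _).2 ⟨hl, fun h0 h => ?_⟩, (ofInt_le_iff _ _).2 ⟨fun h0 h => ?_, hr⟩⟩
  · have h' := ((le_iff _ _).1 h).2
    rw [forall_right_add (P := fun X => ¬ X ≤ _),
      forall_right_ofInt (P := fun X => ¬ X + ofInt n ≤ _),
      forall_right_ofInt (P := fun X => ¬ ofInt m + X ≤ _)] at h'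
    -- As `m + n < 0`, one summand is negative. Right's move raising it by one reaches a game equal
    -- to `m + n + 1`, which `h'` forbids.
    rcases lt_or_ge m 0 with hm | hm
    · refine h'.1 hm ?_
      rw [add_right_comm]
      exact (ofInt_add_ofInt (m + 1) n).1
    · refine h'.2 (by omega) ?_
      rw [add_assoc]
      exact (ofInt_add_ofInt m (n + 1)).1
  · have h' := ((le_iff _ _).1 h).1
    rw [forall_left_add (P := fun X => ¬ _ ≤ X),
      forall_left_ofInt (P := fun X => ¬ _ ≤ X + ofInt n),
      forall_left_ofInt (P := fun X => ¬ _ ≤ ofInt m + X)] at h'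
    rcases lt_or_ge 0 m with hm | hm
    · refine h'.1 hm ?_
      rw [add_sub_right_comm]
      exact (ofInt_add_ofInt (m - 1) n).2
    · refine h'.2 (by omega) ?_
      rw [add_sub_assoc]
      exact (ofInt_add_ofInt m (n - 1)).2
termination_by m.natAbs + n.natAbs

theorem IsInteger.equiv_intValue {G : ShortGame} (h : G.IsInteger) :
    Equiv G (ofInt G.intValue) := by
  have : G.intValue = Classical.choose h := dif_pos h
  rw [this]
  exact Classical.choose_spec h

theorem intValue_eq {G : ShortGame} {n : ℤ} (h : Equiv G (ofInt n)) : G.intValue = n := by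
  have h' := IsInteger.equiv_intValue ⟨n, h⟩
  exact le_antisymm (ofInt_le_ofInt.1 (ShortGame.le_trans h'.2 h.1))
    (ofInt_le_ofInt.1 (ShortGame.le_trans h.2 h'.1))

theorem IsInteger.equiv_add {G H : ShortGame} (hG : G.IsInteger) (hH : H.IsInteger) :
    Equiv (G + H) (ofInt (G.intValue + H.intValue)) :=
  ⟨ShortGame.le_trans (ShortGame.add_le_add hG.equiv_intValue.1 hH.equiv_intValue.1)
    (ofInt_add_ofInt _ _).1,
   ShortGame.le_trans (ofInt_add_ofInt _ _).2
    (ShortGame.add_le_add hG.equiv_intValue.2 hH.equiv_intValue.2)⟩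

/-- A game with an integer strictly between its left and its right options is an integer. -/
theorem isInteger_of_fits {G : ShortGame} (n : ℤ) (hl : ∀ i, ¬ ofInt n ≤ G.left i)
    (hr : ∀ j, ¬ G.right j ≤ ofInt n) : G.IsInteger := by
  -- If `n` fits but is not the value, only the single option of the canonical form of `n` can be at
  -- fault. That option then fits as well and is closer to `0`, so the search ends.
  by_cases h₁ : n < 0 ∧ ofInt (n + 1) ≤ G
  · exact isInteger_of_fits (n + 1)
      (fun i h => hl i (ShortGame.le_trans (ofInt_le_succ n).1 h)) (not_right_le h₁.2)
  by_cases h₂ : 0 < n ∧ G ≤ ofInt (n - 1)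
  · refine isInteger_of_fits (n - 1) (not_le_left h₂.2)
      (fun j h => hr j (ShortGame.le_trans h (ofInt_le_ofInt.2 (by omega))))
  exact ⟨n, (le_ofInt_iff _ _).2 ⟨hl, fun h h' => h₁ ⟨h, h'⟩⟩,
    (ofInt_le_iff _ _).2 ⟨fun h h' => h₂ ⟨h, h'⟩, hr⟩⟩
termination_by n.natAbs

end ShortGame

/-! ### Finite maxima and minima. -/

theorem le_finMax {m : ℕ} (f : Fin m → DyadicRat) (i : Fin m) : f i ≤ finMax f := by
  have h : (Finset.univ : Finset (Fin m)).Nonempty := ⟨i, Finset.mem_univ i⟩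
  rw [finMax, dif_pos h]
  exact Finset.le_sup' f (Finset.mem_univ i)

theorem exists_eq_finMax {m : ℕ} (hm : 0 < m) (f : Fin m → DyadicRat) : ∃ i, finMax f = f i := by
  have h : (Finset.univ : Finset (Fin m)).Nonempty := ⟨⟨0, hm⟩, Finset.mem_univ _⟩
  rw [finMax, dif_pos h]
  obtain ⟨i, -, hi⟩ := Finset.exists_mem_eq_sup' h f
  exact ⟨i, hi⟩

theorem finMin_le {m : ℕ} (f : Fin m → DyadicRat) (i : Fin m) : finMin f ≤ f i := by
  have h : (Finset.univ : Finset (Fin m)).Nonempty := ⟨i, Finset.mem_univ i⟩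
  rw [finMin, dif_pos h]
  exact Finset.inf'_le f (Finset.mem_univ i)

theorem exists_eq_finMin {m : ℕ} (hm : 0 < m) (f : Fin m → DyadicRat) : ∃ i, finMin f = f i := by
  have h : (Finset.univ : Finset (Fin m)).Nonempty := ⟨⟨0, hm⟩, Finset.mem_univ _⟩
  rw [finMin, dif_pos h]
  obtain ⟨i, -, hi⟩ := Finset.exists_mem_eq_inf' h f
  exact ⟨i, hi⟩

theorem neg_finMin {m : ℕ} (f : Fin m → DyadicRat) : -finMin f = finMax fun i => -f i := by
  rcases Nat.eq_zero_or_pos m with rfl | hm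
  · simp [finMin, finMax]
  obtain ⟨i, hi⟩ := exists_eq_finMin hm f
  obtain ⟨j, hj⟩ := exists_eq_finMax hm fun i => -f i
  have h₁ := le_finMax (fun i => -f i) i
  have h₂ := finMin_le f j
  linarith

/-! ### Walls on dyadic grids and their first meeting. -/

namespace DyadicRat

/-- The dyadic rational `1 / 2`. -/
def half : DyadicRat := ⟨1 / 2, Subring.subset_closure rfl⟩

theorem half_add_half : half + half = 1 := by
  apply Subtype.ext
  change (1 / 2 + 1 / 2 : ℚ) = 1
  norm_num

theorem half_pos : 0 < half := by
  have := half_add_half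
  by_contra! h
  linarith

theorem half_pow_pos (k : ℕ) : 0 < half ^ k := pow_pos half_pos k

theorem half_pow_succ (k : ℕ) : half ^ (k + 1) + half ^ (k + 1) = half ^ k := by
  rw [pow_succ, ← mul_add, half_add_half, mul_one]

theorem exists_mul_half_pow (n : ℤ) (k : ℕ) : ∃ i : ℤ, (n : DyadicRat) = i * half ^ k := by
  refine ⟨n * 2 ^ k, ?_⟩
  have h : (2 : DyadicRat) * half = 1 := by rw [two_mul, half_add_half]
  push_cast
  rw [mul_assoc, ← mul_pow, h, one_pow, mul_one]

/-- Functions that are affine with slope `0` or `-1` on each cell of the grid `2⁻ᵏ ℤ`, with values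
in the grid at the points of the grid. -/
structure IsWall (k : ℕ) (f : DyadicRat → DyadicRat) : Prop where
  anti : ∀ s t, s ≤ t → f t ≤ f s
  mono : ∀ s t, s ≤ t → f s + s ≤ f t + t
  grid : ∀ i : ℤ, ∃ j : ℤ, f (i * half ^ k) = j * half ^ k

namespace IsWall

variable {k : ℕ} {f : DyadicRat → DyadicRat}

/-- Over one cell the drop is a multiple of the mesh between `0` and the mesh, hence one of these
two. Either extreme value forces one of the bounds `anti`, `mono` to be an equality throughout the
cell. -/
theorem cell (hf : IsWall k f) (i : ℤ) :
    (∀ t, (i : DyadicRat) * half ^ k ≤ t → t ≤ i * half ^ k + half ^ k → f t = f (i * half ^ k)) ∨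
    (∀ t, (i : DyadicRat) * half ^ k ≤ t → t ≤ i * half ^ k + half ^ k →
      f t = f (i * half ^ k) - (t - i * half ^ k)) := by
  have hδ := half_pow_pos k
  obtain ⟨a, ha⟩ := hf.grid i
  obtain ⟨b, hb⟩ := hf.grid (i + 1)
  push_cast at hb
  rw [add_mul, one_mul] at hb
  have h₁ := hf.anti (i * half ^ k) (i * half ^ k + half ^ k) (by linarith)
  have h₂ := hf.mono (i * half ^ k) (i * half ^ k + half ^ k) (by linarith)
  rw [ha, hb] at h₁ h₂
  have h₃ : b ≤ a := by exact_mod_cast le_of_mul_le_mul_right h₁ hδ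
  have h₄ : a ≤ b + 1 := by
    have : (a : DyadicRat) * half ^ k ≤ (b + 1) * half ^ k := by linarith
    exact_mod_cast le_of_mul_le_mul_right this hδ
  rcases eq_or_lt_of_le h₃ with rfl | h₅
  · left
    intro t ht ht'
    have h₆ := hf.anti _ _ ht
    have h₇ := hf.anti _ _ ht'
    linarith
  · right
    intro t ht ht'
    obtain rfl : a = b + 1 := by omega
    push_cast at ha
    have h₆ := hf.mono _ _ ht
    have h₇ := hf.mono _ _ ht'
    linarith

theorem succ (hf : IsWall k f) : IsWall (k + 1) f where
  anti := hf.anti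
  mono := hf.mono
  grid i := by
    have hδ := half_pow_pos (k + 1)
    have hδ' := half_pow_succ k
    obtain ⟨q, rfl | rfl⟩ := Int.even_or_odd' i
    · obtain ⟨a, ha⟩ := hf.grid q
      refine ⟨2 * a, ?_⟩
      rw [← hδ'] at ha
      push_cast
      rw [show (2 * (q : DyadicRat)) * half ^ (k + 1) = q * (half ^ (k + 1) + half ^ (k + 1)) by ring,
        ha]
      ring
    · obtain ⟨a, ha⟩ := hf.grid q
      have ht : ((2 * q + 1 : ℤ) : DyadicRat) * half ^ (k + 1) = q * half ^ k + half ^ (k + 1) := by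
        rw [← hδ']
        push_cast
        ring
      rw [ht]
      rcases hf.cell q with h | h
      · refine ⟨2 * a, ?_⟩
        rw [h _ (by linarith) (by linarith), ha, ← hδ']
        push_cast
        ring
      · refine ⟨2 * a - 1, ?_⟩
        rw [h _ (by linarith) (by linarith), ha, ← hδ']
        push_cast
        ring

theorem of_le (hf : IsWall k f) {k' : ℕ} (h : k ≤ k') : IsWall k' f := by
  induction k', h using Nat.le_induction with
  | base => exact hf
  | succ n _ ih => exact ih.succ

theorem const (k : ℕ) (n : ℤ) : IsWall k fun _ => (n : DyadicRat) where
  anti _ _ _ := le_rfl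
  mono s t h := by linarith
  grid _ := exists_mul_half_pow n k

theorem finMax {m : ℕ} {F : Fin m → DyadicRat → DyadicRat} (hF : ∀ i, IsWall k (F i)) :
    IsWall k fun t => _root_.finMax fun i => F i t := by
  rcases Nat.eq_zero_or_pos m with rfl | hm
  · simpa [_root_.finMax] using const k 0
  refine ⟨fun s t h => ?_, fun s t h => ?_, fun j => ?_⟩
  · obtain ⟨i, hi⟩ := exists_eq_finMax hm fun i => F i t
    have h₁ := le_finMax (fun i => F i s) i
    have h₂ := (hF i).anti s t h
    linarith
  · obtain ⟨i, hi⟩ := exists_eq_finMax hm fun i => F i s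
    have h₁ := le_finMax (fun i => F i t) i
    have h₂ := (hF i).mono s t h
    linarith
  · obtain ⟨i, hi⟩ := exists_eq_finMax hm fun i => F i (j * half ^ k)
    rw [hi]
    exact (hF i).grid j

/-- Right walls enter as negatives, having slopes `0` and `1`. Subtracting `t` turns these slopes
into `-1` and `0`, which is how a right wall contributes to a left scaffold. -/
theorem sub_id (hf : IsWall k fun t => -f t) : IsWall k fun t => f t - t where
  anti s t h := by
    have := hf.mono s t h
    linarith
  mono s t h := by
    have := hf.anti s t h
    linarith
  grid i := by
    obtain ⟨j, hj⟩ := hf.grid i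
    refine ⟨-j - i, ?_⟩
    push_cast
    linarith

theorem cut (hf : IsWall k f) (i : ℤ) :
    IsWall k fun t => if t ≤ i * half ^ k then f t else f (i * half ^ k) where
  anti s t h := by
    split_ifs with h₁ h₂ h₂
    · exact hf.anti _ _ h
    · exact absurd (h.trans h₁) h₂
    · exact hf.anti _ _ h₂
    · exact le_rfl
  mono s t h := by
    split_ifs with h₁ h₂ h₂
    · exact hf.mono _ _ h
    · have := hf.mono _ _ h₁
      linarith
    · exact absurd (h.trans h₂) h₁
    · linarith
  grid j := by
    split_ifs
    · exact hf.grid j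
    · exact hf.grid i

end IsWall

/-- The gap `l - r` never increases and has slope `0`, `-1` or `-2` on each cell. In the first cell
at whose end it is no longer positive, it starts as a positive multiple of the mesh, so it vanishes
at the end of the cell or, with slope `-2`, possibly at its midpoint. Hence the grid of level `k +
1`. -/
theorem exists_isLeast_meet {k : ℕ} {l r : DyadicRat → DyadicRat} (hl : IsWall k l)
    (hr : IsWall k fun t => -r t) (h₀ : r (-1) < l (-1)) {T : DyadicRat} (hT : l T ≤ r T) :
    ∃ i : ℤ, IsLeast {t | l t = r t} (i * half ^ (k + 1)) ∧ -1 < (i : DyadicRat) * half ^ (k + 1) := by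
  have hδ := half_pow_pos k
  have hδ' := half_pow_succ k
  obtain ⟨p, hp⟩ := exists_mul_half_pow (-1) k
  push_cast at hp
  -- the least grid point at which the walls have met
  have hex : ∃ n : ℕ, l ((p + n : ℤ) * half ^ k) ≤ r ((p + n : ℤ) * half ^ k) := by
    obtain ⟨n, hn⟩ := Archimedean.arch (T + 1) hδ
    refine ⟨n, ?_⟩
    rw [nsmul_eq_mul] at hn
    have hTn : T ≤ ((p + n : ℤ) : DyadicRat) * half ^ k := by
      push_cast
      rw [add_mul, ← hp]
      linarith
    have h₁ := hl.anti _ _ hTn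
    have h₂ := hr.anti _ _ hTn
    linarith
  classical
  obtain ⟨q, hq₀, hq, hq₁⟩ : ∃ q : ℤ, -1 ≤ (q : DyadicRat) * half ^ k ∧
      r (q * half ^ k) < l (q * half ^ k) ∧
      l (q * half ^ k + half ^ k) ≤ r (q * half ^ k + half ^ k) := by
    have hspec := Nat.find_spec hex
    have hmin := fun m => Nat.find_min hex (m := m)
    rcases hn : Nat.find hex with _ | n
    · rw [hn] at hspec
      simp only [Nat.cast_zero, add_zero, ← hp] at hspec
      exact absurd hspec (not_le.2 h₀)
    · rw [hn] at hspec hmin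
      refine ⟨p + n, ?_, not_le.1 (hmin n (Nat.lt_succ_self n)), ?_⟩
      · push_cast
        rw [add_mul, ← hp]
        have : (0 : DyadicRat) ≤ n * half ^ k := by positivity
        linarith
      · have : ((p + (n + 1 : ℕ) : ℤ) : DyadicRat) * half ^ k
            = ((p + n : ℤ) : DyadicRat) * half ^ k + half ^ k := by
          push_cast
          ring
        rwa [this] at hspec
  set g := (q : DyadicRat) * half ^ k with hg
  obtain ⟨a, ha⟩ := hl.grid q
  obtain ⟨b, hb⟩ := hr.grid q
  rw [← hg] at ha hb
  have hab : 1 ≤ a + b := by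
    have : (0 : DyadicRat) * half ^ k < (a + b : ℤ) * half ^ k := by
      push_cast
      linarith
    have := lt_of_mul_lt_mul_right this hδ.le
    have : 0 < a + b := by exact_mod_cast this
    omega
  have before : ∀ t, t ≤ g → l t ≠ r t := by
    intro t ht h
    have h₁ := hl.anti _ _ ht
    have h₂ := hr.anti _ _ ht
    linarith
  have hg' : g + half ^ k = ((2 * q + 2 : ℤ) : DyadicRat) * half ^ (k + 1) := by
    rw [hg, ← hδ']
    push_cast
    ring
  have hg'' : g + half ^ (k + 1) = ((2 * q + 1 : ℤ) : DyadicRat) * half ^ (k + 1) := by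
    rw [hg, ← hδ']
    push_cast
    ring
  have hcell : ∀ τ, g < τ → τ ≤ g + half ^ k → l τ = r τ →
      (∀ t, g ≤ t → t < τ → l t ≠ r t) → IsLeast {t | l t = r t} τ := by
    refine fun τ h₁ h₂ h₃ h₄ => ⟨h₃, fun t ht => ?_⟩
    by_contra! hlt
    rcases le_or_gt t g with h | h
    · exact before t h ht
    · exact h₄ t h.le hlt ht
  have habδ : half ^ k ≤ l g - r g := by
    have : ((1 : ℤ) : DyadicRat) ≤ (a + b : ℤ) := by exact_mod_cast hab
    have := mul_le_mul_of_nonneg_right this hδ.le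
    push_cast at this
    linarith
  have hend : g ≤ g + half ^ k := by linarith
  have one_sided : l g - r g ≤ half ^ k →
      (∀ t, g ≤ t → t ≤ g + half ^ k → l t - r t = l g - r g - (t - g)) →
      IsLeast {t | l t = r t} (g + half ^ k) := by
    intro h₁ h₂
    refine hcell _ (by linarith) le_rfl ?_ fun t ht ht' h => ?_
    · have := h₂ _ hend le_rfl
      linarith
    · have := h₂ _ ht ht'.le
      linarith
  have hδ₁ := half_pow_pos (k + 1)
  -- With both walls constant on the cell the gap could not close. With exactly one moving, the
  -- slope is `-1` and the gap closes at the end.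
  rcases hl.cell q with cl | cl <;> rcases hr.cell q with cr | cr <;> rw [← hg] at cl cr
  · have h₁ := cl _ hend le_rfl
    have h₂ := cr _ hend le_rfl
    linarith
  · refine ⟨2 * q + 2, ?_⟩
    rw [← hg']
    refine ⟨one_sided ?_ fun t h₁ h₂ => ?_, by linarith⟩
    · have h₁ := cl _ hend le_rfl
      have h₂ := cr _ hend le_rfl
      linarith
    · have h₃ := cl _ h₁ h₂
      have h₄ := cr _ h₁ h₂
      linarith
  · refine ⟨2 * q + 2, ?_⟩
    rw [← hg']
    refine ⟨one_sided ?_ fun t h₁ h₂ => ?_, by linarith⟩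
    · have h₁ := cl _ hend le_rfl
      have h₂ := cr _ hend le_rfl
      linarith
    · have h₃ := cl _ h₁ h₂
      have h₄ := cr _ h₁ h₂
      linarith
  · rcases eq_or_lt_of_le hab with h1 | h1
    · refine ⟨2 * q + 1, ?_⟩
      rw [← hg'']
      have hgap : l g - r g = half ^ k := by
        have : ((a + b : ℤ) : DyadicRat) = 1 := by rw [← h1, Int.cast_one]
        push_cast at this
        have : (a + b) * half ^ k = half ^ k := by rw [this, one_mul]
        linarith
      refine ⟨hcell _ (by linarith) (by linarith) ?_ fun t ht ht' h => ?_, by linarith⟩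
      · have h₃ := cl (g + half ^ (k + 1)) (by linarith) (by linarith)
        have h₄ := cr (g + half ^ (k + 1)) (by linarith) (by linarith)
        linarith
      · have h₃ := cl t (by linarith) (by linarith)
        have h₄ := cr t (by linarith) (by linarith)
        linarith
    · refine ⟨2 * q + 2, ?_⟩
      rw [← hg']
      have hgap : half ^ k + half ^ k ≤ l g - r g := by
        have : ((2 : ℤ) : DyadicRat) ≤ (a + b : ℤ) := by exact_mod_cast h1
        have := mul_le_mul_of_nonneg_right this hδ.le
        push_cast at this
        linarith
      refine ⟨hcell _ (by linarith) le_rfl ?_ fun t ht ht' h => ?_, by linarith⟩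
      · have h₃ := cl _ hend le_rfl
        have h₄ := cr _ hend le_rfl
        linarith
      · have h₃ := cl t (by linarith) (by linarith)
        have h₄ := cr t (by linarith) (by linarith)
        linarith

end DyadicRat

/-! ### Freezing two scaffolds. -/

open DyadicRat

theorem DyadicRat.exists_int_le_lt_add_one (a : DyadicRat) :
    ∃ n : ℤ, (n : DyadicRat) ≤ a ∧ a < n + 1 := by
  obtain ⟨n, ⟨h₁, h₂⟩, -⟩ := existsUnique_add_zsmul_mem_Ico (zero_lt_one' DyadicRat) a 0
  simp only [zsmul_eq_mul, mul_one, zero_add] at h₁ h₂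
  refine ⟨-n, ?_, ?_⟩ <;> push_cast <;> linarith

theorem meetTime_isLeast {l r : DyadicRat → DyadicRat} (h : ∃ t, IsLeast {t | l t = r t} t) :
    IsLeast {t | l t = r t} (meetTime l r) := by
  rw [meetTime, dif_pos h]
  exact Classical.choose_spec h

/-- The properties that the thermographs of all games have. -/
structure ThermographData.Regular (D : ThermographData) : Prop where
  walls : ∃ k, IsWall k D.leftWall ∧ IsWall k fun t => -D.rightWall t
  le : ∀ t, D.rightWall t ≤ D.leftWall t
  bddAbove : ∃ B, ∀ t, D.rightWall t ≤ B
  bddBelow : ∃ B, ∀ t, B ≤ D.leftWall t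

theorem freeze_regular {k : ℕ} {l r : DyadicRat → DyadicRat} (hl : IsWall k l)
    (hr : IsWall k fun t => -r t) (h₀ : r (-1) < l (-1)) {T : DyadicRat} (hT : l T ≤ r T) :
    (freeze l r).Regular ∧ IsLeast {t | l t = r t} (meetTime l r) ∧ -1 < meetTime l r := by
  obtain ⟨i, hi, hi₁⟩ := exists_isLeast_meet hl hr h₀ hT
  have hm := meetTime_isLeast ⟨_, hi⟩
  have hτ := hm.unique hi
  refine ⟨⟨⟨k + 1, ?_, ?_⟩, fun t => ?_, ⟨r (meetTime l r), fun t => ?_⟩,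
    ⟨l (meetTime l r), fun t => ?_⟩⟩, hm, hτ ▸ hi₁⟩
  · simp only [freeze, hτ]
    exact hl.succ.cut i
  · simp only [freeze, hτ]
    convert hr.succ.cut i using 2
    split_ifs <;> rfl
  · have hm' : l _ = r _ := hm.1
    simp only [freeze]
    split_ifs with h
    · have h₁ := hl.anti _ _ h
      have h₂ := hr.anti _ _ h
      linarith
    · exact hm'.ge
  · simp only [freeze]
    split_ifs with h
    · have := hr.anti _ _ h
      linarith
    · exact le_rfl
  · simp only [freeze]
    split_ifs with h
    · exact hl.anti _ _ h
    · exact le_rfl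

/-! ### Thermographs, comparison with integers, and existence of the temperature. -/

namespace ShortGame

theorem thermograph_of_isInteger {G : ShortGame} (h : G.IsInteger) :
    G.thermograph = ⟨fun _ => G.intValue, fun _ => G.intValue, ⊥⟩ := by
  cases G
  rw [thermograph, if_pos h]

theorem thermograph_of_not_isInteger {G : ShortGame} (h : ¬ G.IsInteger) :
    G.thermograph = freeze G.leftScaffold G.rightScaffold := by
  cases G
  rw [thermograph, if_neg h]
  rfl

theorem leftScaffold_ge (G : ShortGame) (i) (t : DyadicRat) :
    (G.left i).thermograph.rightWall t - t ≤ G.leftScaffold t :=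
  le_finMax (fun i => (G.left i).thermograph.rightWall t - t) i

theorem rightScaffold_le (G : ShortGame) (j) (t : DyadicRat) :
    G.rightScaffold t ≤ (G.right j).thermograph.leftWall t + t :=
  finMin_le (fun j => (G.right j).thermograph.leftWall t + t) j

/-- The comparisons of a game with integers, as they show in its thermograph. -/
structure Bounded (G : ShortGame) : Prop where
  regular : G.thermograph.Regular
  left_le : ∀ (n : ℤ) (s : DyadicRat), -1 ≤ s → G ≤ ofInt n → G.thermograph.leftWall s ≤ n
  right_le : ∀ (n : ℤ) (s : DyadicRat), -1 ≤ s → ¬ ofInt n ≤ G → G.thermograph.rightWall s ≤ n + s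
  right_ge : ∀ (n : ℤ) (s : DyadicRat), -1 ≤ s → ofInt n ≤ G → n ≤ G.thermograph.rightWall s
  left_ge : ∀ (n : ℤ) (s : DyadicRat), -1 ≤ s → ¬ G ≤ ofInt n → n - s ≤ G.thermograph.leftWall s

/-- `G` is not an integer, and its scaffolds are cut at their first meeting at time `τ`. -/
structure FreezesAt (G : ShortGame) (τ : DyadicRat) : Prop where
  not_isInteger : ¬ G.IsInteger
  numLeft_pos : 0 < G.numLeft
  numRight_pos : 0 < G.numRight
  isLeast : IsLeast {t | G.leftScaffold t = G.rightScaffold t} τ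
  temp_eq : G.temp = τ
  neg_one_lt : -1 < τ
  leftWall_eq : ∀ t, G.thermograph.leftWall t =
    if t ≤ τ then G.leftScaffold t else G.leftScaffold τ
  rightWall_eq : ∀ t, G.thermograph.rightWall t =
    if t ≤ τ then G.rightScaffold t else G.rightScaffold τ
  left_anti : ∀ s t, s ≤ t → G.leftScaffold t ≤ G.leftScaffold s
  right_mono : ∀ s t, s ≤ t → G.rightScaffold s ≤ G.rightScaffold t

theorem exists_isWall_leftScaffold {G : ShortGame} (h : ∀ i, (G.left i).thermograph.Regular) :
    ∃ k, IsWall k G.leftScaffold := by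
  choose k _ hk using fun i => (h i).walls
  exact ⟨Finset.univ.sup k, IsWall.finMax fun i =>
    ((hk i).of_le (Finset.le_sup (Finset.mem_univ i))).sub_id⟩

theorem exists_isWall_rightScaffold {G : ShortGame} (h : ∀ j, (G.right j).thermograph.Regular) :
    ∃ k, IsWall k fun t => -G.rightScaffold t := by
  choose k hk _ using fun j => (h j).walls
  refine ⟨Finset.univ.sup k, ?_⟩
  have : (fun t => -G.rightScaffold t) =
      fun t => finMax fun j => -(G.right j).thermograph.leftWall t - t := by
    funext t
    rw [rightScaffold, neg_finMin]
    congr 1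
    funext j
    ring
  rw [this]
  refine IsWall.finMax fun j => IsWall.sub_id ?_
  simpa using (hk j).of_le (Finset.le_sup (Finset.mem_univ j))

theorem exists_scaffold_le {G : ShortGame} (hl : ∀ i, (G.left i).thermograph.Regular)
    (hr : ∀ j, (G.right j).thermograph.Regular) (hL : 0 < G.numLeft) (hR : 0 < G.numRight) :
    ∃ T, G.leftScaffold T ≤ G.rightScaffold T := by
  choose A hA using fun i => (hl i).bddAbove
  choose B hB using fun j => (hr j).bddBelow
  -- At time `T` the left scaffold is at most `finMax A - T` and the right one at least `finMin B +
  -- T`, so `finMax A - finMin B ≤ 2 * T` suffices.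
  refine ⟨max 0 (finMax A - finMin B), ?_⟩
  set T := max 0 (finMax A - finMin B)
  have h₀ : 0 ≤ T := le_max_left _ _
  have h₁ : finMax A - finMin B ≤ T := le_max_right _ _
  obtain ⟨i, hi⟩ := exists_eq_finMax hL fun i => (G.left i).thermograph.rightWall T - T
  obtain ⟨j, hj⟩ := exists_eq_finMin hR fun j => (G.right j).thermograph.leftWall T + T
  have h₂ := hA i T
  have h₃ := hB j T
  have h₄ := le_finMax A i
  have h₅ := finMin_le B j
  rw [leftScaffold, rightScaffold, hi, hj]
  linarith

theorem numLeft_pos {G : ShortGame} (hr : ∀ j, (G.right j).Bounded) (hG : ¬ G.IsInteger) :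
    0 < G.numLeft := by
  by_contra! h₀
  -- If Right options are missing too, the scaffold takes its default value; any integer then fits.
  obtain ⟨n, hn, -⟩ := exists_int_le_lt_add_one (G.rightScaffold (-1))
  refine hG (isInteger_of_fits n (fun i => absurd i.2 (by omega)) fun j h => ?_)
  have h₁ := (hr j).left_le n (-1) le_rfl h
  have h₂ := G.rightScaffold_le j (-1)
  linarith

theorem numRight_pos {G : ShortGame} (hl : ∀ i, (G.left i).Bounded) (hG : ¬ G.IsInteger) :
    0 < G.numRight := by
  by_contra! h₀
  obtain ⟨n, hn, hn'⟩ := exists_int_le_lt_add_one (G.leftScaffold (-1))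
  refine hG (isInteger_of_fits (n + 1) (fun i h => ?_) fun j => absurd j.2 (by omega))
  have h₁ := (hl i).right_ge (n + 1) (-1) le_rfl h
  have h₂ := G.leftScaffold_ge i (-1)
  push_cast at h₁
  linarith

/-- Otherwise the floor `n` of the left scaffold at `-1` fits: a Left option above `n` would lift
that scaffold to `n + 1`, and a Right option below `n` would push the right scaffold down to `n -
1`. -/
theorem rightScaffold_lt_leftScaffold {G : ShortGame} (hl : ∀ i, (G.left i).Bounded)
    (hr : ∀ j, (G.right j).Bounded) (hG : ¬ G.IsInteger) :
    G.rightScaffold (-1) < G.leftScaffold (-1) := by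
  by_contra! h₀
  obtain ⟨n, hn, hn'⟩ := exists_int_le_lt_add_one (G.leftScaffold (-1))
  refine hG (isInteger_of_fits n (fun i h => ?_) fun j h => ?_)
  · have h₁ := (hl i).right_ge n (-1) le_rfl h
    have h₂ := G.leftScaffold_ge i (-1)
    linarith
  · have h₁ := (hr j).left_le n (-1) le_rfl h
    have h₂ := G.rightScaffold_le j (-1)
    linarith

theorem exists_freezesAt {G : ShortGame} (hl : ∀ i, (G.left i).Bounded)
    (hr : ∀ j, (G.right j).Bounded) (hG : ¬ G.IsInteger) :
    G.thermograph.Regular ∧ ∃ τ, G.FreezesAt τ := by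
  have hL := numLeft_pos hr hG
  have hR := numRight_pos hl hG
  obtain ⟨a, ha⟩ := exists_isWall_leftScaffold fun i => (hl i).regular
  obtain ⟨b, hb⟩ := exists_isWall_rightScaffold fun j => (hr j).regular
  obtain ⟨T, hT⟩ := exists_scaffold_le (fun i => (hl i).regular) (fun j => (hr j).regular) hL hR
  obtain ⟨h₁, h₂, h₃⟩ := freeze_regular (ha.of_le (le_max_left a b)) (hb.of_le (le_max_right a b))
    (rightScaffold_lt_leftScaffold hl hr hG) hT
  have hth := thermograph_of_not_isInteger hG
  refine ⟨hth ▸ h₁, meetTime G.leftScaffold G.rightScaffold, hG, hL, hR, h₂, ?_, h₃, fun t => ?_,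
    fun t => ?_, ha.anti, fun s t h => neg_le_neg_iff.1 (hb.anti s t h)⟩
  · rw [temp, hth]
    rfl
  · rw [hth]
    rfl
  · rw [hth]
    rfl

namespace FreezesAt

variable {G : ShortGame} {τ s : DyadicRat}

theorem leftScaffold_le (h : G.FreezesAt τ) (s) :
    G.leftScaffold s ≤ G.thermograph.leftWall s := by
  rw [h.leftWall_eq]
  split_ifs with hs
  · exact le_rfl
  · exact h.left_anti _ _ (not_le.1 hs).le

theorem le_rightScaffold (h : G.FreezesAt τ) (s) :
    G.thermograph.rightWall s ≤ G.rightScaffold s := by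
  rw [h.rightWall_eq]
  split_ifs with hs
  · exact le_rfl
  · exact h.right_mono _ _ (not_le.1 hs).le

theorem exists_left (h : G.FreezesAt τ) (hs : s ≤ τ) :
    ∃ i, G.thermograph.leftWall s = (G.left i).thermograph.rightWall s - s := by
  rw [h.leftWall_eq, if_pos hs]
  exact exists_eq_finMax h.numLeft_pos _

theorem exists_right (h : G.FreezesAt τ) (hs : s ≤ τ) :
    ∃ j, G.thermograph.rightWall s = (G.right j).thermograph.leftWall s + s := by
  rw [h.rightWall_eq, if_pos hs]
  exact exists_eq_finMin h.numRight_pos _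

theorem leftWall_of_ge (h : G.FreezesAt τ) (hs : τ ≤ s) :
    G.thermograph.leftWall s = G.thermograph.leftWall τ := by
  rw [h.leftWall_eq, h.leftWall_eq, if_pos le_rfl]
  split_ifs with h'
  · rw [le_antisymm h' hs]
  · rfl

theorem rightWall_of_ge (h : G.FreezesAt τ) (hs : τ ≤ s) :
    G.thermograph.rightWall s = G.thermograph.rightWall τ := by
  rw [h.rightWall_eq, h.rightWall_eq, if_pos le_rfl]
  split_ifs with h'
  · rw [le_antisymm h' hs]
  · rfl

theorem walls_eq_iff (h : G.FreezesAt τ) :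
    G.thermograph.leftWall s = G.thermograph.rightWall s ↔ τ ≤ s := by
  refine ⟨fun h' => ?_, fun h' => ?_⟩
  · by_contra! hs
    rw [h.leftWall_eq, h.rightWall_eq, if_pos hs.le, if_pos hs.le] at h'
    exact absurd (h.isLeast.2 h') (not_le.2 hs)
  · rw [h.leftWall_of_ge h', h.rightWall_of_ge h', h.leftWall_eq, h.rightWall_eq, if_pos le_rfl,
      if_pos le_rfl]
    exact h.isLeast.1

theorem bounded (h : G.FreezesAt τ) (hreg : G.thermograph.Regular)
    (hl : ∀ i, (G.left i).Bounded) (hr : ∀ j, (G.right j).Bounded) : G.Bounded := by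
  have key_l : ∀ (n : ℤ) (s : DyadicRat), -1 ≤ s → s ≤ τ → G ≤ ofInt n →
      G.thermograph.leftWall s ≤ n := by
    intro n s hs hsτ hn
    obtain ⟨i, hi⟩ := h.exists_left hsτ
    have := (hl i).right_le n s hs (not_le_left hn i)
    linarith
  have key_r : ∀ (n : ℤ) (s : DyadicRat), -1 ≤ s → s ≤ τ → ofInt n ≤ G →
      n ≤ G.thermograph.rightWall s := by
    intro n s hs hsτ hn
    obtain ⟨j, hj⟩ := h.exists_right hsτ
    have := (hr j).left_ge n s hs (not_right_le hn j)
    linarith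
  have left_le : ∀ (n : ℤ) (s : DyadicRat), -1 ≤ s → G ≤ ofInt n →
      G.thermograph.leftWall s ≤ n := by
    intro n s hs hn
    rcases le_total s τ with hsτ | hsτ
    · exact key_l n s hs hsτ hn
    · rw [h.leftWall_of_ge hsτ]
      exact key_l n τ h.neg_one_lt.le le_rfl hn
  have right_ge : ∀ (n : ℤ) (s : DyadicRat), -1 ≤ s → ofInt n ≤ G →
      n ≤ G.thermograph.rightWall s := by
    intro n s hs hn
    rcases le_total s τ with hsτ | hsτ
    · exact key_r n s hs hsτ hn
    · rw [h.rightWall_of_ge hsτ]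
      exact key_r n τ h.neg_one_lt.le le_rfl hn
  refine ⟨hreg, left_le, fun n s hs hn => ?_, right_ge, fun n s hs hn => ?_⟩
  · rw [ofInt_le_iff] at hn
    -- The failure of `ofInt n ≤ G` has two possible witnesses: the integer `n - 1`, where `s ≥ -1`
    -- gives `n - 1 ≤ n + s`, or a Right option of `G`.
    by_cases hc : G ≤ ofInt (n - 1)
    · have h₁ := left_le _ s hs hc
      have h₂ := hreg.le s
      push_cast at h₁
      linarith
    · simp only [hc, not_false_eq_true, implies_true, true_and, not_forall, not_not] at hn
      obtain ⟨j, hj⟩ := hn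
      have h₁ := (hr j).left_le n s hs hj
      have h₂ := h.le_rightScaffold s
      have h₃ := G.rightScaffold_le j s
      linarith
  · rw [le_ofInt_iff] at hn
    by_cases hc : ofInt (n + 1) ≤ G
    · have h₁ := right_ge _ s hs hc
      have h₂ := hreg.le s
      push_cast at h₁
      linarith
    · simp only [hc, not_false_eq_true, implies_true, and_true, not_forall, not_not] at hn
      obtain ⟨i, hi⟩ := hn
      have h₁ := (hl i).right_ge n s hs hi
      have h₂ := h.leftScaffold_le s
      have h₃ := G.leftScaffold_ge i s
      linarith

end FreezesAt

theorem IsInteger.bounded {G : ShortGame} (h : G.IsInteger) : G.Bounded := by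
  have hv := h.equiv_intValue
  rcases hth : G.thermograph with ⟨l, r, t⟩
  rw [thermograph_of_isInteger h] at hth
  obtain ⟨rfl, rfl, rfl⟩ := ThermographData.mk.inj hth
  have hth := thermograph_of_isInteger h
  refine ⟨⟨⟨0, ?_, ?_⟩, ?_, ⟨G.intValue, ?_⟩, ⟨G.intValue, ?_⟩⟩, fun n s hs hn => ?_,
    fun n s hs hn => ?_, fun n s hs hn => ?_, fun n s hs hn => ?_⟩ <;> rw [hth] <;> dsimp only
  · exact IsWall.const 0 _
  · simpa using IsWall.const 0 (-G.intValue)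
  · exact fun _ => le_rfl
  · exact fun _ => le_rfl
  · exact fun _ => le_rfl
  · exact_mod_cast ofInt_le_ofInt.1 (ShortGame.le_trans hv.2 hn)
  · have h₁ : ¬ n ≤ G.intValue := fun h₁ =>
      hn (ShortGame.le_trans (ofInt_le_ofInt.2 h₁) hv.2)
    have h₂ : (G.intValue : DyadicRat) + 1 ≤ n := by exact_mod_cast not_le.1 h₁
    linarith
  · exact_mod_cast ofInt_le_ofInt.1 (ShortGame.le_trans hn hv.1)
  · have h₁ : ¬ G.intValue ≤ n := fun h₁ =>
      hn (ShortGame.le_trans hv.1 (ofInt_le_ofInt.2 h₁))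
    have h₂ : (n : DyadicRat) + 1 ≤ G.intValue := by exact_mod_cast not_le.1 h₁
    linarith

theorem bounded (G : ShortGame) : G.Bounded := by
  by_cases hG : G.IsInteger
  · exact hG.bounded
  have hl := fun i => bounded (G.left i)
  have hr := fun j => bounded (G.right j)
  obtain ⟨hreg, τ, hτ⟩ := exists_freezesAt hl hr hG
  exact hτ.bounded hreg hl hr
termination_by G.birthday
decreasing_by
  · exact birthday_left_lt G i
  · exact birthday_right_lt G j

theorem isInteger_or_exists_freezesAt (G : ShortGame) : G.IsInteger ∨ ∃ τ, G.FreezesAt τ :=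
  or_iff_not_imp_left.2 fun hG =>
    (exists_freezesAt (fun i => bounded (G.left i)) (fun j => bounded (G.right j)) hG).2

theorem rightWall_le_leftWall (G : ShortGame) (s : DyadicRat) :
    G.thermograph.rightWall s ≤ G.thermograph.leftWall s :=
  G.bounded.regular.le s

/-- An integer has no scaffold in its thermograph, and its given form may still have options; for it
the bound comes from comparing the option with the integer value. -/
theorem rightWall_left_sub_le (G : ShortGame) (i) {s : DyadicRat} (hs : -1 ≤ s) :
    (G.left i).thermograph.rightWall s - s ≤ G.thermograph.leftWall s := by
  rcases G.isInteger_or_exists_freezesAt with hG | ⟨τ, hτ⟩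
  · have hv := hG.equiv_intValue
    have := (G.left i).bounded.right_le _ s hs (not_le_left hv.1 i)
    rw [thermograph_of_isInteger hG]
    dsimp only
    linarith
  · exact (G.leftScaffold_ge i s).trans (hτ.leftScaffold_le s)

theorem le_leftWall_right_add (G : ShortGame) (j) {s : DyadicRat} (hs : -1 ≤ s) :
    G.thermograph.rightWall s ≤ (G.right j).thermograph.leftWall s + s := by
  rcases G.isInteger_or_exists_freezesAt with hG | ⟨τ, hτ⟩
  · have hv := hG.equiv_intValue
    have := (G.right j).bounded.left_ge _ s hs (not_right_le hv.2 j)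
    rw [thermograph_of_isInteger hG]
    dsimp only
    linarith
  · exact (hτ.le_rightScaffold s).trans (G.rightScaffold_le j s)

theorem tempWellDefined (G : ShortGame) : G.TempWellDefined := by
  intro hG
  obtain ⟨τ, hτ⟩ := G.isInteger_or_exists_freezesAt.resolve_left hG
  exact ⟨hτ.numLeft_pos, hτ.numRight_pos, τ, hτ.isLeast, hτ.temp_eq⟩

end ShortGame

/-! ### Reading the temperature off the walls. -/

theorem eq_bot_or_exists_coe (x : WithBot DyadicRat) : x = ⊥ ∨ ∃ m : DyadicRat, x = m := by
  induction x with
  | bot => exact Or.inl rfl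
  | coe m => exact Or.inr ⟨m, rfl⟩

namespace ShortGame

theorem IsInteger.temp_eq_bot {G : ShortGame} (h : G.IsInteger) : G.temp = ⊥ := by
  rw [temp, thermograph_of_isInteger h]

theorem isInteger_of_temp_eq_bot {G : ShortGame} (h : G.temp = ⊥) : G.IsInteger := by
  rcases G.isInteger_or_exists_freezesAt with hG | ⟨τ, hτ⟩
  · exact hG
  · exact absurd (hτ.temp_eq.symm.trans h) (WithBot.coe_ne_bot)

theorem freezesAt_of_le_temp {G : ShortGame} {s : DyadicRat} (h : s ≤ G.temp) :
    ∃ τ, G.FreezesAt τ ∧ s ≤ τ := by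
  rcases G.isInteger_or_exists_freezesAt with hG | ⟨τ, hτ⟩
  · rw [hG.temp_eq_bot] at h
    exact absurd h (not_le.2 (WithBot.bot_lt_coe s))
  · rw [hτ.temp_eq] at h
    exact ⟨τ, hτ, WithBot.coe_le_coe.1 h⟩

theorem neg_one_lt_of_temp_eq {G : ShortGame} {τ : DyadicRat} (h : G.temp = τ) : -1 < τ := by
  obtain ⟨σ, hσ, hle⟩ := freezesAt_of_le_temp h.ge
  rw [hσ.temp_eq, WithBot.coe_inj] at h
  exact h ▸ hσ.neg_one_lt

theorem walls_eq_iff_temp_le {G : ShortGame} {s : DyadicRat} :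
    G.thermograph.leftWall s = G.thermograph.rightWall s ↔ G.temp ≤ s := by
  rcases G.isInteger_or_exists_freezesAt with hG | ⟨τ, hτ⟩
  · rw [hG.temp_eq_bot, thermograph_of_isInteger hG]
    simp
  · rw [hτ.walls_eq_iff, hτ.temp_eq, WithBot.coe_le_coe]

theorem rightWall_of_temp_le {G : ShortGame} {m s : DyadicRat} (h : G.temp ≤ m) (hs : m ≤ s) :
    G.thermograph.rightWall s = G.thermograph.rightWall m := by
  rcases G.isInteger_or_exists_freezesAt with hG | ⟨τ, hτ⟩
  · rw [thermograph_of_isInteger hG]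
  · rw [hτ.temp_eq, WithBot.coe_le_coe] at h
    rw [hτ.rightWall_of_ge h, hτ.rightWall_of_ge (h.trans hs)]

theorem leftWall_of_temp_le {G : ShortGame} {m s : DyadicRat} (h : G.temp ≤ m) (hs : m ≤ s) :
    G.thermograph.leftWall s = G.thermograph.leftWall m := by
  rw [walls_eq_iff_temp_le.2 (h.trans (WithBot.coe_le_coe.2 hs)), walls_eq_iff_temp_le.2 h,
    rightWall_of_temp_le h hs]

theorem IsInteger.add {G H : ShortGame} (hG : G.IsInteger) (hH : H.IsInteger) :
    (G + H).IsInteger :=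
  ⟨_, hG.equiv_add hH⟩

theorem rightWall_left_add_sub_le (G H : ShortGame) (i) {s : DyadicRat} (hs : -1 ≤ s) :
    (G.left i + H).thermograph.rightWall s - s ≤ (G + H).thermograph.leftWall s :=
  ((forall_left_add (P := fun X => X.thermograph.rightWall s - s ≤ _) G H).1
    fun i => rightWall_left_sub_le _ i hs).1 i

theorem rightWall_add_left_sub_le (G H : ShortGame) (i) {s : DyadicRat} (hs : -1 ≤ s) :
    (G + H.left i).thermograph.rightWall s - s ≤ (G + H).thermograph.leftWall s :=
  ((forall_left_add (P := fun X => X.thermograph.rightWall s - s ≤ _) G H).1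
    fun i => rightWall_left_sub_le _ i hs).2 i

theorem le_leftWall_right_add_add (G H : ShortGame) (j) {s : DyadicRat} (hs : -1 ≤ s) :
    (G + H).thermograph.rightWall s ≤ (G.right j + H).thermograph.leftWall s + s :=
  ((forall_right_add (P := fun X => _ ≤ X.thermograph.leftWall s + s) G H).1
    fun j => le_leftWall_right_add _ j hs).1 j

theorem le_leftWall_add_right_add (G H : ShortGame) (j) {s : DyadicRat} (hs : -1 ≤ s) :
    (G + H).thermograph.rightWall s ≤ (G + H.right j).thermograph.leftWall s + s :=
  ((forall_right_add (P := fun X => _ ≤ X.thermograph.leftWall s + s) G H).1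
    fun j => le_leftWall_right_add _ j hs).2 j

/-- To compare walls of two games and of their sum at one time, it is enough to do so when the three
games are integers, and at times at which one of them is not yet frozen. -/
theorem of_le_temp {G H K : ShortGame} {P : DyadicRat → Prop}
    (hint : G.IsInteger → H.IsInteger → K.IsInteger → ∀ s, P s)
    (hhot : ∀ s : DyadicRat, -1 ≤ s → s ≤ G.temp ∨ s ≤ H.temp ∨ s ≤ K.temp → P s)
    (hcold : ∀ m s : DyadicRat, G.temp ≤ m → H.temp ≤ m → K.temp ≤ m → m ≤ s → P m → P s)
    (s : DyadicRat) (hs : -1 ≤ s) : P s := by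
  have hmax : ∀ m : DyadicRat, max G.temp (max H.temp K.temp) = m →
      G.temp = m ∨ H.temp = m ∨ K.temp = m := by
    intro m hm
    rcases max_choice G.temp (max H.temp K.temp) with h | h
    · exact Or.inl (h.symm.trans hm)
    rcases max_choice H.temp K.temp with h' | h'
    · exact Or.inr (Or.inl (h'.symm.trans (h.symm.trans hm)))
    · exact Or.inr (Or.inr (h'.symm.trans (h.symm.trans hm)))
  obtain hM | ⟨m, hM⟩ : max G.temp (max H.temp K.temp) = ⊥ ∨
      ∃ m : DyadicRat, max G.temp (max H.temp K.temp) = m :=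
    eq_bot_or_exists_coe _
  · have h := max_le_iff.1 (le_of_eq hM)
    rw [max_le_iff] at h
    exact hint (isInteger_of_temp_eq_bot (le_bot_iff.1 h.1))
      (isInteger_of_temp_eq_bot (le_bot_iff.1 h.2.1))
      (isInteger_of_temp_eq_bot (le_bot_iff.1 h.2.2)) s
  have h := max_le_iff.1 (le_of_eq hM)
  rw [max_le_iff] at h
  have hm := hmax m hM
  rcases le_total s m with hsm | hsm
  · have hsm' := WithBot.coe_le_coe.2 hsm
    exact hhot s hs (hm.imp (hsm'.trans ·.ge) (Or.imp (hsm'.trans ·.ge) (hsm'.trans ·.ge)))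
  · have h₁ : -1 < m := by
      rcases hm with e | e | e <;> exact neg_one_lt_of_temp_eq e
    exact hcold m s h.1 h.2.1 h.2.2 hsm
      (hhot m h₁.le (hm.imp (·.ge) (Or.imp (·.ge) (·.ge))))

/-! ### Walls of sums and the temperature bound. -/

/-- The three inequalities need one induction: moving in the hot summand reduces a mixed inequality
to the first one for an option, and a Right move in `G + H` reduces the first to a mixed one. A
frozen summand has equal walls, so there the mixed inequality follows from the first. -/
theorem walls_add_ge (G H : ShortGame) (s : DyadicRat) (hs : -1 ≤ s) :
    G.thermograph.rightWall s + H.thermograph.rightWall s ≤ (G + H).thermograph.rightWall s ∧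
    G.thermograph.rightWall s + H.thermograph.leftWall s ≤ (G + H).thermograph.leftWall s ∧
    G.thermograph.leftWall s + H.thermograph.rightWall s ≤ (G + H).thermograph.leftWall s := by
  have hG : ∀ s : DyadicRat, -1 ≤ s → s ≤ G.temp →
      G.thermograph.leftWall s + H.thermograph.rightWall s ≤ (G + H).thermograph.leftWall s := by
    intro s hs hst
    obtain ⟨τ, hτ, hle⟩ := freezesAt_of_le_temp hst
    obtain ⟨i, hi⟩ := hτ.exists_left hle
    have h₁ := (walls_add_ge (G.left i) H s hs).1
    have h₂ := rightWall_left_add_sub_le G H i hs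
    linarith
  have hH : ∀ s : DyadicRat, -1 ≤ s → s ≤ H.temp →
      G.thermograph.rightWall s + H.thermograph.leftWall s ≤ (G + H).thermograph.leftWall s := by
    intro s hs hst
    obtain ⟨τ, hτ, hle⟩ := freezesAt_of_le_temp hst
    obtain ⟨i, hi⟩ := hτ.exists_left hle
    have h₁ := (walls_add_ge G (H.left i) s hs).1
    have h₂ := rightWall_add_left_sub_le G H i hs
    linarith
  have hK : ∀ s : DyadicRat, -1 ≤ s → s ≤ (G + H).temp →
      G.thermograph.rightWall s + H.thermograph.rightWall s ≤ (G + H).thermograph.rightWall s := by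
    intro s hs hst
    obtain ⟨τ, hτ, hle⟩ := freezesAt_of_le_temp hst
    obtain ⟨j, hj⟩ := hτ.exists_right hle
    rw [hj]
    -- The equation picking out the optimal option stays inside the predicate, so that the options
    -- of the sum can be split by summand.
    revert j
    rw [forall_right_add (P := fun X => _ = X.thermograph.leftWall s + s →
      _ ≤ X.thermograph.leftWall s + s)]
    refine ⟨fun j _ => ?_, fun j _ => ?_⟩
    · have h₁ := (walls_add_ge (G.right j) H s hs).2.2
      have h₂ := le_leftWall_right_add G j hs
      linarith
    · have h₁ := (walls_add_ge G (H.right j) s hs).2.1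
      have h₂ := le_leftWall_right_add H j hs
      linarith
  have key : ∀ s : DyadicRat, -1 ≤ s →
      G.thermograph.rightWall s + H.thermograph.rightWall s ≤ (G + H).thermograph.rightWall s := by
    refine of_le_temp (G := G) (H := H) (K := G + H) (fun h₁ h₂ h₃ s => ?_) (fun s hs h => ?_)
      fun m s h₁ h₂ h₃ h h' => ?_
    · rw [thermograph_of_isInteger h₁, thermograph_of_isInteger h₂, thermograph_of_isInteger h₃,
        intValue_eq (h₁.equiv_add h₂)]
      push_cast
      exact le_rfl
    · rcases le_total (s : WithBot DyadicRat) (G + H).temp with hc | hc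
      · exact hK s hs hc
      -- The sum is frozen here, so a lower bound for its left wall, available from a hot summand,
      -- is one for its right wall.
      have hc := walls_eq_iff_temp_le.2 hc
      rcases h with h | h | h
      · have h₁ := hG s hs h
        have h₂ := G.rightWall_le_leftWall s
        linarith
      · have h₁ := hH s hs h
        have h₂ := H.rightWall_le_leftWall s
        linarith
      · exact hK s hs h
    · rwa [rightWall_of_temp_le h₁ h, rightWall_of_temp_le h₂ h, rightWall_of_temp_le h₃ h]
  have hle := (G + H).rightWall_le_leftWall s
  refine ⟨key s hs, ?_, ?_⟩
  · rcases le_total (s : WithBot DyadicRat) H.temp with hc | hc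
    · exact hH s hs hc
    · rw [walls_eq_iff_temp_le.2 hc]
      exact (key s hs).trans hle
  · rcases le_total (s : WithBot DyadicRat) G.temp with hc | hc
    · exact hG s hs hc
    · rw [walls_eq_iff_temp_le.2 hc]
      exact (key s hs).trans hle
termination_by G.birthday + H.birthday
decreasing_by
  · have := birthday_left_lt G i
    omega
  · have := birthday_left_lt H i
    omega
  · have := birthday_right_lt G j
    omega
  · have := birthday_right_lt H j
    omega

theorem walls_add_le (G H : ShortGame) (s : DyadicRat) (hs : -1 ≤ s) :
    (G + H).thermograph.leftWall s ≤ G.thermograph.leftWall s + H.thermograph.leftWall s ∧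
    (G + H).thermograph.rightWall s ≤ G.thermograph.leftWall s + H.thermograph.rightWall s ∧
    (G + H).thermograph.rightWall s ≤ G.thermograph.rightWall s + H.thermograph.leftWall s := by
  have hG : ∀ s : DyadicRat, -1 ≤ s → s ≤ G.temp →
      (G + H).thermograph.rightWall s ≤ G.thermograph.rightWall s + H.thermograph.leftWall s := by
    intro s hs hst
    obtain ⟨τ, hτ, hle⟩ := freezesAt_of_le_temp hst
    obtain ⟨j, hj⟩ := hτ.exists_right hle
    have h₁ := (walls_add_le (G.right j) H s hs).1
    have h₂ := le_leftWall_right_add_add G H j hs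
    linarith
  have hH : ∀ s : DyadicRat, -1 ≤ s → s ≤ H.temp →
      (G + H).thermograph.rightWall s ≤ G.thermograph.leftWall s + H.thermograph.rightWall s := by
    intro s hs hst
    obtain ⟨τ, hτ, hle⟩ := freezesAt_of_le_temp hst
    obtain ⟨j, hj⟩ := hτ.exists_right hle
    have h₁ := (walls_add_le G (H.right j) s hs).1
    have h₂ := le_leftWall_add_right_add G H j hs
    linarith
  have hK : ∀ s : DyadicRat, -1 ≤ s → s ≤ (G + H).temp →
      (G + H).thermograph.leftWall s ≤ G.thermograph.leftWall s + H.thermograph.leftWall s := by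
    intro s hs hst
    obtain ⟨τ, hτ, hle⟩ := freezesAt_of_le_temp hst
    obtain ⟨i, hi⟩ := hτ.exists_left hle
    rw [hi]
    revert i
    rw [forall_left_add (P := fun X => _ = X.thermograph.rightWall s - s →
      X.thermograph.rightWall s - s ≤ _)]
    refine ⟨fun i _ => ?_, fun i _ => ?_⟩
    · have h₁ := (walls_add_le (G.left i) H s hs).2.2
      have h₂ := rightWall_left_sub_le G i hs
      linarith
    · have h₁ := (walls_add_le G (H.left i) s hs).2.1
      have h₂ := rightWall_left_sub_le H i hs
      linarith
  have key : ∀ s : DyadicRat, -1 ≤ s →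
      (G + H).thermograph.leftWall s ≤ G.thermograph.leftWall s + H.thermograph.leftWall s := by
    refine of_le_temp (G := G) (H := H) (K := G + H) (fun h₁ h₂ h₃ s => ?_) (fun s hs h => ?_)
      fun m s h₁ h₂ h₃ h h' => ?_
    · rw [thermograph_of_isInteger h₁, thermograph_of_isInteger h₂, thermograph_of_isInteger h₃,
        intValue_eq (h₁.equiv_add h₂)]
      push_cast
      exact le_rfl
    · rcases le_total (s : WithBot DyadicRat) (G + H).temp with hc | hc
      · exact hK s hs hc
      have hc := walls_eq_iff_temp_le.2 hc
      rcases h with h | h | h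
      · have h₁ := hG s hs h
        have h₂ := G.rightWall_le_leftWall s
        linarith
      · have h₁ := hH s hs h
        have h₂ := H.rightWall_le_leftWall s
        linarith
      · exact hK s hs h
    · rwa [leftWall_of_temp_le h₁ h, leftWall_of_temp_le h₂ h, leftWall_of_temp_le h₃ h]
  have hle := (G + H).rightWall_le_leftWall s
  refine ⟨key s hs, ?_, ?_⟩
  · rcases le_total (s : WithBot DyadicRat) H.temp with hc | hc
    · exact hH s hs hc
    · rw [← walls_eq_iff_temp_le.2 hc]
      exact hle.trans (key s hs)
  · rcases le_total (s : WithBot DyadicRat) G.temp with hc | hc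
    · exact hG s hs hc
    · rw [← walls_eq_iff_temp_le.2 hc]
      exact hle.trans (key s hs)
termination_by G.birthday + H.birthday
decreasing_by
  · have := birthday_right_lt G j
    omega
  · have := birthday_right_lt H j
    omega
  · have := birthday_left_lt G i
    omega
  · have := birthday_left_lt H i
    omega

theorem temp_add_le (G H : ShortGame) : (G + H).temp ≤ max G.temp H.temp := by
  obtain hM | ⟨m, hM⟩ : max G.temp H.temp = ⊥ ∨ ∃ m : DyadicRat, max G.temp H.temp = m :=
    eq_bot_or_exists_coe _
  · have h := max_le_iff.1 (le_of_eq hM)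
    rw [hM]
    rw [((isInteger_of_temp_eq_bot (le_bot_iff.1 h.1)).add
      (isInteger_of_temp_eq_bot (le_bot_iff.1 h.2))).temp_eq_bot]
  have h := max_le_iff.1 (le_of_eq hM)
  rw [hM]
  have hm : -1 < m := by
    rcases max_choice G.temp H.temp with e | e <;>
      exact neg_one_lt_of_temp_eq (e.symm.trans hM)
  -- At `m` the upper bound for the left wall of the sum and the lower bound for its right wall are
  -- the same number.
  refine walls_eq_iff_temp_le.1 (le_antisymm ?_ (rightWall_le_leftWall _ _))
  have h₁ := (walls_add_le G H m hm.le).1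
  have h₂ := (walls_add_ge G H m hm.le).1
  rw [walls_eq_iff_temp_le.2 h.1, walls_eq_iff_temp_le.2 h.2] at h₁
  exact h₁.trans h₂

end ShortGame

theorem corollary7p3 :
    (∀ K : ShortGame, K.TempWellDefined) ∧
      ∀ G H : ShortGame, (G + H).temp ≤ max G.temp H.temp :=
  ⟨ShortGame.tempWellDefined, ShortGame.temp_add_le⟩
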